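/- Stability of the law of the iterated logarithm (upper half). A set $\psi\subseteq\{0,1\}^*\times\{0,1\}^*$ is called a computable monotone operation if it is recursively enumerable; if $(p,x),(p',x')\in\psi$ and $p$ is a prefix of $p'$, then one of $x,x'$ is a prefix of the other; and if $(p,x)\in\psi$, then $(p,x')\in\psi$ for every prefix $x'$ of $x$. Put $Km_\psi(x)=\min\{l(p):(p,x)\in\psi\}$, where $l(p)$ is the length of $p$ and $\min\emptyset=\infty$. Fix an optimal $\psi$, i.e. a computable monotone operation such that for every computable monotone operation $\psi'$ there is a constant $c$ with $Km_\psi(x)\le Km_{\psi'}(x)+c$ for all strings $x$ (such a $\psi$ exists); $Km=Km_\psi$ is the monotone Kolmogorov complexity. For an infinite binary sequence $\omega=\omega_1\omega_2\dots$ let $\omega^m=\omega_1\dots\omega_m$ and $S_n=\sum_{i=1}^n\omega_i$. Let $\rho:\mathbb N\to\mathbb R$ be any unbounded nondecreasing computable function (the values can be computed to any prescribed accuracy, uniformly in the argument) such that $\rho(m)=o(\log_2\log_2 m)$ as $m\to\infty$. Let $\omega$ be an infinite binary sequence for which there is a constant $c$ such that $Km(\omega^m)\ge m-\rho(m)-c$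 for all $m$. Then $$\limsup_{n\to\infty}\frac{\left|S_n-\frac n2\right|}{\sqrt{\frac12\,n\ln\ln n}}\le 1 .$$ -/

import Mathlib

open Filter Asymptotics

/-! ## Monotone Kolmogorov complexity

Binary strings are lists of Booleans, `x <+: y` means that `x` is a prefix of `y`. -/

namespace MonotoneComplexity

/-- `ψ` is a computable representation of a monotone operation on binary sequences. A pair
`(p, x) ∈ ψ` means that the decoded sequence `ψ(p)` begins with `x`. -/
structure IsMonotoneOperation (ψ : Set (List Bool × List Bool)) : Prop where
  re : REPred fun a : List Bool × List Bool => a ∈ ψ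
  comparable : ∀ p x p' x', (p, x) ∈ ψ → (p', x') ∈ ψ → p <+: p' → x <+: x' ∨ x' <+: x
  prefix_closed : ∀ p x x', (p, x) ∈ ψ → x' <+: x → (p, x') ∈ ψ

/-- The monotone complexity `Km_ψ(x) = min {l(p) : (p, x) ∈ ψ}`, with `min ∅ = ∞`. -/
noncomputable def KmOf (ψ : Set (List Bool × List Bool)) (x : List Bool) : ℕ∞ :=
  ⨅ (p : List Bool) (_ : (p, x) ∈ ψ), (p.length : ℕ∞)

/-- `ψ` is an optimal computable monotone operation. -/
def IsOptimal (ψ : Set (List Bool × List Bool)) : Prop :=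
  IsMonotoneOperation ψ ∧
    ∀ ψ', IsMonotoneOperation ψ' → ∃ c : ℕ, ∀ x, KmOf ψ x ≤ KmOf ψ' x + c

/-! ### Existence of an optimal operation

A universal operation is obtained by trimming every recursively enumerable set of pairs to a
monotone operation, uniformly in its index, and by reading a self-delimiting index first. -/

theorem rePred_exists {α W : Type*} [Primcodable α] [Primcodable W] {R : α → W → Prop}
    (hR : PrimrecRel R) : REPred fun a => ∃ w, R a w := by
  classical
  have h1 : Computable₂ fun (a : α) (n : ℕ) =>
      ((Encodable.decode n : Option W).bind
        fun w => if R a w then some () else none : Option Unit) := by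
    apply Primrec.to_comp
    refine Primrec.option_bind (Primrec.decode.comp Primrec.snd) ?_
    refine Primrec.ite ?_ (Primrec.const _) (Primrec.const _)
    exact hR.comp (Primrec.fst.comp Primrec.fst) Primrec.snd
  refine (Partrec.rfindOpt h1).dom_re.of_eq fun a => ?_
  rw [Nat.rfindOpt_dom]
  constructor
  · rintro ⟨n, u, h⟩
    simp only [Option.mem_def, Option.bind_eq_some_iff] at h
    obtain ⟨w, -, hw⟩ := h
    by_cases hr : R a w
    · exact ⟨w, hr⟩
    · simp [hr] at hw
  · rintro ⟨w, hw⟩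
    exact ⟨Encodable.encode w, (), by simp [hw]⟩

theorem primrecRel_prefix : PrimrecRel fun x y : List Bool => x <+: y := by
  refine (Primrec.eq.comp (Primrec.fst (α := List Bool) (β := List Bool))
    (Primrec.list_take.comp (Primrec.list_length.comp Primrec.fst) Primrec.snd)).of_eq ?_
  rintro ⟨x, y⟩
  exact List.prefix_iff_eq_take.symm

/-- The pairs that the program `c` enumerates within `s` steps. -/
def stage (c : Nat.Partrec.Code) (s : ℕ) : List (List Bool × List Bool) :=
  (List.range s).filterMap fun k =>
    (Nat.Partrec.Code.evaln s c k).bind fun _ => Encodable.decode k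

theorem mem_stage {c : Nat.Partrec.Code} {s : ℕ} {a : List Bool × List Bool} :
    a ∈ stage c s ↔ ∃ k v, v ∈ Nat.Partrec.Code.evaln s c k ∧ Encodable.decode k = some a := by
  simp only [stage, List.mem_filterMap, List.mem_range, Option.bind_eq_some_iff, Option.mem_def]
  constructor
  · rintro ⟨k, -, v, h, h'⟩
    exact ⟨k, v, h, h'⟩
  · rintro ⟨k, v, h, h'⟩
    exact ⟨k, Nat.Partrec.Code.evaln_bound h, v, h, h'⟩

theorem stage_mono {c : Nat.Partrec.Code} {s t : ℕ} (h : s ≤ t) {a : List Bool × List Bool}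
    (ha : a ∈ stage c s) : a ∈ stage c t := by
  rw [mem_stage] at ha ⊢
  obtain ⟨k, v, h1, h2⟩ := ha
  exact ⟨k, v, Nat.Partrec.Code.evaln_mono h h1, h2⟩

theorem primrec_stage : Primrec₂ stage := by
  refine Primrec.listFilterMap (Primrec.list_range.comp Primrec.snd) ?_
  refine Primrec.option_bind ?_ ?_
  · exact Nat.Partrec.Code.primrec_evaln.comp
      (((Primrec.snd.comp Primrec.fst).pair (Primrec.fst.comp Primrec.fst)).pair Primrec.snd)
  · exact Primrec.decode.comp (Primrec.snd.comp Primrec.fst)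

/-- Compatibility of the members of a finite list of pairs. -/
def Consistent (l : List (List Bool × List Bool)) : Prop :=
  ∀ a ∈ l, ∀ b ∈ l, a.1 <+: b.1 → a.2 <+: b.2 ∨ b.2 <+: a.2

theorem primrec_consistent : PrimrecPred Consistent := by
  have h0 : PrimrecRel fun (a b : List Bool × List Bool) =>
      a.1 <+: b.1 → a.2 <+: b.2 ∨ b.2 <+: a.2 := by
    have f1 : Primrec fun q : (List Bool × List Bool) × (List Bool × List Bool) => q.1.1 :=
      Primrec.fst.comp Primrec.fst
    have f2 : Primrec fun q : (List Bool × List Bool) × (List Bool × List Bool) => q.1.2 :=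
      Primrec.snd.comp Primrec.fst
    have f3 : Primrec fun q : (List Bool × List Bool) × (List Bool × List Bool) => q.2.1 :=
      Primrec.fst.comp Primrec.snd
    have f4 : Primrec fun q : (List Bool × List Bool) × (List Bool × List Bool) => q.2.2 :=
      Primrec.snd.comp Primrec.snd
    refine ((primrecRel_prefix.comp f1 f3).not.or
      ((primrecRel_prefix.comp f2 f4).or (primrecRel_prefix.comp f4 f2))).of_eq fun q => ?_
    tauto
  have h1 := h0.forall_mem_list
  have h2 : PrimrecRel fun (b : List Bool × List Bool) (l : List (List Bool × List Bool)) =>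
      ∀ a ∈ l, a.1 <+: b.1 → a.2 <+: b.2 ∨ b.2 <+: a.2 := h1.comp Primrec.snd Primrec.fst
  refine (h2.forall_mem_list.comp Primrec.id Primrec.id).of_eq fun l => ?_
  exact ⟨fun h a ha b hb => h b hb a ha, fun h b hb a ha => h a ha b hb⟩

/-- `(p, x)` belongs to the monotone operation with index `c`. -/
def Trimmed (c : Nat.Partrec.Code) (p x : List Bool) : Prop :=
  ∃ s, Consistent (stage c s) ∧ ∃ y, (p, y) ∈ stage c s ∧ x <+: y

theorem Trimmed.comparable {c : Nat.Partrec.Code} {p x p' x' : List Bool} (h : Trimmed c p x)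
    (h' : Trimmed c p' x') (hp : p <+: p') : x <+: x' ∨ x' <+: x := by
  obtain ⟨s, hs, y, hy, hx⟩ := h
  obtain ⟨t, ht, z, hz, hx'⟩ := h'
  have key : y <+: z ∨ z <+: y := by
    rcases le_total s t with hst | hst
    · exact ht _ (stage_mono hst hy) _ hz hp
    · exact hs _ hy _ (stage_mono hst hz) hp
  rcases key with k | k
  · exact List.prefix_or_prefix_of_prefix (hx.trans k) hx'
  · exact List.prefix_or_prefix_of_prefix hx (hx'.trans k)

theorem exists_code_trimmed {ψ : Set (List Bool × List Bool)} (hψ : IsMonotoneOperation ψ) :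
    ∃ c, ∀ p x, (p, x) ∈ ψ → Trimmed c p x := by
  obtain ⟨c, hc⟩ := Nat.Partrec.Code.exists_code.1 hψ.re
  have hmem : ∀ a, (∃ s, a ∈ stage c s) → a ∈ ψ := by
    rintro a ⟨s, hs⟩
    obtain ⟨k, v, hv, hk⟩ := mem_stage.1 hs
    have h1 := Nat.Partrec.Code.evaln_sound hv
    rw [hc] at h1
    simp [hk] at h1
    exact h1.1
  refine ⟨c, fun p x h => ?_⟩
  have h1 : Encodable.encode () ∈ Nat.Partrec.Code.eval c (Encodable.encode (p, x)) := by
    rw [hc]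
    simp only [Encodable.encodek, Part.coe_some, Part.bind_some]
    exact Part.mem_map _ (by simp [h])
  obtain ⟨s, hs⟩ := Nat.Partrec.Code.evaln_complete.1 h1
  refine ⟨s, ?_, x, mem_stage.2 ⟨_, _, hs, Encodable.encodek _⟩, List.prefix_rfl⟩
  intro a ha b hb hab
  exact hψ.comparable a.1 a.2 b.1 b.2 (hmem a ⟨s, ha⟩) (hmem b ⟨s, hb⟩) hab

/-- The self-delimiting code of a natural number. -/
def header (i : ℕ) : List Bool := List.replicate i true ++ [false]

theorem header_inj : ∀ {i j : ℕ} {p q : List Bool}, header i ++ p <+: header j ++ q →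
    i = j ∧ p <+: q
  | 0, 0, p, q, h => by simpa [header] using h
  | 0, j + 1, p, q, h => by simp [header, List.replicate_succ] at h
  | i + 1, 0, p, q, h => by simp [header, List.replicate_succ] at h
  | i + 1, j + 1, p, q, h => by
      have h' : header i ++ p <+: header j ++ q := by
        simpa [header, List.replicate_succ] using h
      obtain ⟨h1, h2⟩ := header_inj h'
      exact ⟨by rw [h1], h2⟩

/-- A universal monotone operation. -/
def universal : Set (List Bool × List Bool) :=
  {a | ∃ (i : ℕ) (p : List Bool), a.1 = header i ++ p ∧
    Trimmed (Denumerable.ofNat Nat.Partrec.Code i) p a.2}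

theorem primrec_header : Primrec header := by
  have h : Primrec fun i : ℕ => (List.range i).map fun _ => true :=
    Primrec.list_map Primrec.list_range (Primrec.const true).to₂
  refine (Primrec.list_append.comp h (Primrec.const [false])).of_eq fun i => ?_
  simp [header]

theorem re_universal : REPred fun a : List Bool × List Bool => a ∈ universal := by
  have hR : PrimrecRel fun (a : List Bool × List Bool)
      (w : (ℕ × List Bool) × (ℕ × List Bool)) =>
      (a.1 = header w.1.1 ++ w.1.2 ∧ a.2 <+: w.2.2) ∧
      (Consistent (stage (Denumerable.ofNat Nat.Partrec.Code w.1.1) w.2.1) ∧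
        ∃ b ∈ stage (Denumerable.ofNat Nat.Partrec.Code w.1.1) w.2.1, b = (w.1.2, w.2.2)) := by
    let T := (List Bool × List Bool) × ((ℕ × List Bool) × (ℕ × List Bool))
    have fx : Primrec fun q : T => q.1.1 := Primrec.fst.comp Primrec.fst
    have fy : Primrec fun q : T => q.1.2 := Primrec.snd.comp Primrec.fst
    have fi : Primrec fun q : T => q.2.1.1 := Primrec.fst.comp (Primrec.fst.comp Primrec.snd)
    have fp : Primrec fun q : T => q.2.1.2 := Primrec.snd.comp (Primrec.fst.comp Primrec.snd)
    have fs : Primrec fun q : T => q.2.2.1 := Primrec.fst.comp (Primrec.snd.comp Primrec.snd)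
    have fz : Primrec fun q : T => q.2.2.2 := Primrec.snd.comp (Primrec.snd.comp Primrec.snd)
    have fst' : Primrec fun q : T => stage (Denumerable.ofNat Nat.Partrec.Code q.2.1.1) q.2.2.1 :=
      primrec_stage.comp ((Primrec.ofNat _).comp fi) fs
    exact ((Primrec.eq.comp fx (Primrec.list_append.comp (primrec_header.comp fi) fp)).and
      (primrecRel_prefix.comp fy fz)).and
      ((primrec_consistent.comp fst').and
        (Primrec.eq.exists_mem_list.comp fst' (fp.pair fz)))
  refine (rePred_exists hR).of_eq fun a => ?_
  constructor
  · rintro ⟨⟨⟨i, p⟩, s, z⟩, ⟨h1, h2⟩, h3, b, h4, rfl⟩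
    exact ⟨i, p, h1, s, h3, z, h4, h2⟩
  · rintro ⟨i, p, h1, s, h3, z, h4, h2⟩
    exact ⟨⟨⟨i, p⟩, s, z⟩, ⟨h1, h2⟩, h3, _, h4, rfl⟩

theorem isMonotoneOperation_universal : IsMonotoneOperation universal where
  re := re_universal
  comparable := by
    rintro _ x _ x' ⟨i, p, rfl, h⟩ ⟨j, q, rfl, h'⟩ hpq
    obtain ⟨rfl, hpq'⟩ := header_inj hpq
    exact h.comparable h' hpq'
  prefix_closed := by
    rintro _ x x' ⟨i, p, rfl, s, hs, y, hy, hxy⟩ hx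
    exact ⟨i, p, rfl, s, hs, y, hy, hx.trans hxy⟩

theorem exists_isOptimal : ∃ ψ, IsOptimal ψ := by
  refine ⟨universal, isMonotoneOperation_universal, fun ψ' hψ' => ?_⟩
  obtain ⟨c, hc⟩ := exists_code_trimmed hψ'
  refine ⟨Encodable.encode c + 1, fun x => ?_⟩
  unfold KmOf
  simp only [ENat.iInf_add]
  refine le_iInf₂ fun p hp => ?_
  refine (iInf₂_le (header (Encodable.encode c) ++ p)
    ⟨Encodable.encode c, p, rfl, by simpa using hc p x hp⟩).trans ?_
  simp [header, add_left_comm]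

/-- A fixed optimal monotone operation. -/
noncomputable def optimal : Set (List Bool × List Bool) := exists_isOptimal.choose

theorem isOptimal_optimal : IsOptimal optimal := exists_isOptimal.choose_spec

theorem isMonotoneOperation_identity :
    IsMonotoneOperation {a : List Bool × List Bool | a.2 <+: a.1} where
  re := (primrecRel_prefix.comp Primrec.snd Primrec.fst).computablePred.to_re
  comparable := fun _ _ _ _ h h' hp => List.prefix_or_prefix_of_prefix (h.trans hp) h'
  prefix_closed := fun _ _ _ h h' => h'.trans h

theorem KmOf_optimal_lt_top (x : List Bool) : KmOf optimal x < ⊤ := by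
  obtain ⟨c, hc⟩ := isOptimal_optimal.2 _ isMonotoneOperation_identity
  have h1 : KmOf {a : List Bool × List Bool | a.2 <+: a.1} x ≤ x.length :=
    iInf₂_le x (List.prefix_rfl : x <+: x)
  calc KmOf optimal x ≤ x.length + c := (hc x).trans (by gcongr)
    _ < ⊤ := by exact_mod_cast ENat.natCast_lt_top (x.length + c)

/-- The monotone Kolmogorov complexity `Km(x)`. -/
noncomputable def Km (x : List Bool) : ℕ := (KmOf optimal x).toNat

/-- `Km` has no junk values. -/
theorem coe_Km (x : List Bool) : (Km x : ℕ∞) = KmOf optimal x :=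
  ENat.natCast_toNat (KmOf_optimal_lt_top x).ne

end MonotoneComplexity

/-! ## Sequences and computable real functions -/

/-- The initial segment `ω^m` of length `m` of an infinite binary sequence `ω`, whose terms
`ω_1, ω_2, …` are `ω 0, ω 1, …`. -/
def initialSegment (ω : ℕ → Bool) (m : ℕ) : List Bool := List.ofFn fun i : Fin m => ω i

/-- `S_n = ω_1 + ⋯ + ω_n`. -/
def partialSum (ω : ℕ → Bool) (n : ℕ) : ℕ := ∑ i ∈ Finset.range n, (ω i).toNat

/-- A real-valued function of a natural argument is computable if its values can be computed
to any prescribed accuracy, uniformly in the argument. -/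
def IsComputableReal (ρ : ℕ → ℝ) : Prop :=
  ∃ f : ℕ → ℕ → ℤ, Computable₂ f ∧ ∀ n k, |ρ n - (f n k : ℝ) / 2 ^ k| ≤ 1 / 2 ^ k

/-! A large fluctuation makes an initial segment compressible. Suppose the limsup exceeds some r >
1, and fix a rational κ = a / b strictly between 2 ln 2 and 2 r² ln 2. For infinitely many n, with l
the integer part of log₂ log₂ n, one has (2 S_n - n)² ≥ κ n l, because ln ln n is l ln 2 up to a
bounded error (`eventually_deviates`).

Among the strings of length M = 2^2^2^(i+1), those with such a fluctuation at some n with l in [2^i,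
2^(i+1)) are rare. For one l the times n span 2^l dyadic scales, and each scale carries probability
of order exp(-κ l / 2), up to an arbitrarily small loss in the exponent. The product is of order
θ^l, where θ < 1 is possible because κ > 2 ln 2. Ville's inequality for a mixture of exponential
supermartingales makes this precise (`length_filter_strings_le`, `one_le_mixture`, `mixture_nil_le`)
and leaves at most 2^(M - 2^i/c) strings for large i (`eventually_length_deviators_le`).

Such a string is described by i in unary and its position in the list, so Km ≤ M - 2^i/c + i + O(1)
(`exists_Km_le_of_mem_list`). Grouping the l dyadically keeps the index cheap: about i bits against
a saving of order 2^i. Since log₂ log₂ M = 2^(i+1), also ρ(M) = o(2^i), and the lower bound on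
Km(ω^M) fails for large i (`eventually_not_deviates`). -/

namespace MonotoneComplexity

/-! ### Describing the members of a computable sequence of finite lists -/

/-- The list of all binary strings of length `n`. -/
def strings : ℕ → List (List Bool)
  | 0 => [[]]
  | n + 1 => (strings n).map (List.cons true) ++ (strings n).map (List.cons false)

theorem mem_strings : ∀ {n : ℕ} {x : List Bool}, x ∈ strings n ↔ x.length = n
  | 0, x => by simp [strings]
  | n + 1, [] => by simp [strings]
  | n + 1, true :: x => by simp [strings, mem_strings]
  | n + 1, false :: x => by simp [strings, mem_strings]

theorem length_strings : ∀ n : ℕ, (strings n).length = 2 ^ n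
  | 0 => rfl
  | n + 1 => by simp [strings, length_strings n, pow_succ, mul_two]

theorem nodup_strings : ∀ n : ℕ, (strings n).Nodup
  | 0 => by simp [strings]
  | n + 1 => by
      have h := nodup_strings n
      refine List.nodup_append.2 ⟨h.map (List.cons_injective), h.map (List.cons_injective), ?_⟩
      simp only [List.mem_map]
      rintro _ ⟨x, -, rfl⟩ _ ⟨y, -, rfl⟩
      simp

theorem primrec_strings : Primrec strings := by
  have hc : ∀ b : Bool, Primrec fun l : List (List Bool) => l.map (List.cons b) := fun b =>
    Primrec.list_map Primrec.id (Primrec.list_cons.comp (Primrec.const b) Primrec.snd)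
  have hstep : Primrec₂ fun (_ : ℕ) (l : List (List Bool)) =>
      l.map (List.cons true) ++ l.map (List.cons false) :=
    Primrec.list_append.comp ((hc true).comp Primrec.snd) ((hc false).comp Primrec.snd)
  refine (Primrec.nat_rec₁ [[]] hstep).of_eq fun n => ?_
  induction n with
  | zero => rfl
  | succ n ih => simp only [strings, ← ih]

/-- A string in the `i`-th list of `A` is described by `header i` followed by a string of length
`L i` that encodes its position. -/
def listOperation (A : ℕ → List (List Bool)) (L : ℕ → ℕ) : Set (List Bool × List Bool) :=
  {a | ∃ (i : ℕ) (q y : List Bool), a.1 = header i ++ q ∧ q.length = L i ∧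
    (A i)[(strings (L i)).idxOf q]? = some y ∧ a.2 <+: y}

/-- The header fixes i, and i fixes the length of the rest, so the descriptions form a prefix-free
set: comparable descriptions are equal and decode to the same string. -/
theorem isMonotoneOperation_listOperation {A : ℕ → List (List Bool)} {L : ℕ → ℕ}
    (hA : Primrec A) (hL : Primrec L) : IsMonotoneOperation (listOperation A L) where
  re := by
    have hR : PrimrecRel fun (a : List Bool × List Bool) (w : ℕ × List Bool × List Bool) =>
        (a.1 = header w.1 ++ w.2.1 ∧ w.2.1.length = L w.1) ∧
        ((A w.1)[(strings (L w.1)).idxOf w.2.1]? = some w.2.2 ∧ a.2 <+: w.2.2) := by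
      let T := (List Bool × List Bool) × (ℕ × List Bool × List Bool)
      have fp : Primrec fun t : T => t.1.1 := Primrec.fst.comp Primrec.fst
      have fx : Primrec fun t : T => t.1.2 := Primrec.snd.comp Primrec.fst
      have fi : Primrec fun t : T => t.2.1 := Primrec.fst.comp Primrec.snd
      have fq : Primrec fun t : T => t.2.2.1 := Primrec.fst.comp (Primrec.snd.comp Primrec.snd)
      have fy : Primrec fun t : T => t.2.2.2 := Primrec.snd.comp (Primrec.snd.comp Primrec.snd)
      refine PrimrecPred.and (PrimrecPred.and ?_ ?_) (PrimrecPred.and ?_ ?_)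
      · exact Primrec.eq.comp fp (Primrec.list_append.comp (primrec_header.comp fi) fq)
      · exact Primrec.eq.comp (Primrec.list_length.comp fq) (hL.comp fi)
      · have hidx : Primrec fun t : T => (strings (L t.2.1)).idxOf t.2.2.1 := by
          convert Primrec.list_idxOf.comp fq (primrec_strings.comp (hL.comp fi)) using 3
          -- The two sides differ only in the `BEq` instance, and lawful instances coincide.
          exact lawful_beq_subsingleton _ _
        exact Primrec.eq.comp (Primrec.list_getElem?.comp (hA.comp fi) hidx)
          (Primrec.option_some.comp fy)
      · exact primrecRel_prefix.comp fx fy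
    refine (rePred_exists hR).of_eq fun a => ?_
    constructor
    · rintro ⟨⟨i, q, y⟩, ⟨h1, h2⟩, h3, h4⟩
      exact ⟨i, q, y, h1, h2, h3, h4⟩
    · rintro ⟨i, q, y, h1, h2, h3, h4⟩
      exact ⟨⟨i, q, y⟩, ⟨h1, h2⟩, h3, h4⟩
  comparable := by
    rintro _ x _ x' ⟨i, q, y, rfl, hq, hy, hx⟩ ⟨j, q', y', rfl, hq', hy', hx'⟩ hp
    obtain ⟨rfl, hp'⟩ := header_inj hp
    obtain rfl : q = q' := hp'.eq_of_length (hq.trans hq'.symm)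
    obtain rfl : y = y' := by rw [hy] at hy'; exact Option.some.inj hy'
    exact List.prefix_or_prefix_of_prefix hx hx'
  prefix_closed := by
    rintro _ x x' ⟨i, q, y, rfl, hq, hy, hx⟩ h
    exact ⟨i, q, y, rfl, hq, hy, h.trans hx⟩

/-- The cost is i + 1 bits of header, L i bits of position and the constant of optimality. The size
bound is required only at the index in question, so it may fail for finitely many i. -/
theorem exists_Km_le_of_mem_list {A : ℕ → List (List Bool)} {L : ℕ → ℕ}
    (hA : Primrec A) (hL : Primrec L) :
    ∃ c : ℕ, ∀ i, (A i).length ≤ 2 ^ L i → ∀ x ∈ A i, Km x ≤ i + L i + c := by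
  obtain ⟨c, hc⟩ := isOptimal_optimal.2 _ (isMonotoneOperation_listOperation hA hL)
  refine ⟨1 + c, fun i hi x hx => ?_⟩
  obtain ⟨k, hk, rfl⟩ := List.mem_iff_getElem.1 hx
  have hk' : k < (strings (L i)).length := by rw [length_strings]; exact hk.trans_le hi
  have hlen : ((strings (L i))[k]).length = L i := mem_strings.1 (List.getElem_mem hk')
  have h1 : KmOf (listOperation A L) (A i)[k] ≤ ((i + 1 + L i : ℕ) : ℕ∞) := by
    refine (iInf₂_le (header i ++ (strings (L i))[k]) ⟨i, _, (A i)[k], rfl, hlen, ?_,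
      List.prefix_rfl⟩).trans (Nat.cast_le.2 ?_)
    · simp only [header, List.length_append, List.length_replicate, hlen, List.length_singleton]
      exact le_rfl
    rw [(nodup_strings _).idxOf_getElem k hk', List.getElem?_eq_getElem hk]
  have h2 : (Km (A i)[k] : ℕ∞) ≤ ((i + L i + (1 + c) : ℕ) : ℕ∞) := by
    rw [coe_Km]
    refine (hc _).trans ((add_le_add_left h1 _).trans (le_of_eq ?_))
    push_cast
    ring
  exact_mod_cast h2

/-! ### The strings that violate the law of the iterated logarithm -/

/-- The absolute difference of the numbers of ones and zeros. -/
def discrepancy (x : List Bool) : ℕ :=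
  (2 * x.count true - x.length) + (x.length - 2 * x.count true)

/-- Some initial segment of length `n`, where `log₂ log₂ n` has integer part
`l ∈ [2 ^ i, 2 ^ (i + 1))`, has a discrepancy of at least `√(a n l / b)`. -/
def Deviates (a b i : ℕ) (x : List Bool) : Prop :=
  ∃ n ∈ List.range (x.length + 1), ∃ l ∈ List.range (2 ^ (i + 1)),
    (2 ^ i ≤ l ∧ 2 ^ 2 ^ l ≤ n) ∧ n < 2 ^ 2 ^ (l + 1) ∧ a * n * l ≤ b * discrepancy (x.take n) ^ 2

theorem primrec_pow : Primrec₂ fun m n : ℕ => m ^ n :=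
  Primrec₂.unpaired'.1 Nat.Primrec.pow

theorem primrec_discrepancy : Primrec discrepancy := by
  have hc : Primrec fun x : List Bool => 2 * x.count true := by
    have h : PrimrecPred fun b : Bool => b = true := Primrec.eq.comp Primrec.id (Primrec.const _)
    refine (Primrec.nat_mul.comp (Primrec.const 2)
      (Primrec.list_length.comp (Primrec.listFilter h))).of_eq fun x => ?_
    rw [List.count_eq_length_filter]
    congr 3
  exact Primrec.nat_add.comp (Primrec.nat_sub.comp hc Primrec.list_length)
    (Primrec.nat_sub.comp Primrec.list_length hc)

/-- The quantifiers are bounded and the inequality is between natural numbers; this is why κ is a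
fraction a / b and the deviation is squared. -/
theorem primrecRel_deviates (a b : ℕ) :
    PrimrecRel fun (x : List Bool) (i : ℕ) => Deviates a b i x := by
  have h0 : PrimrecRel fun (l : ℕ) (w : ℕ × List Bool × ℕ) =>
      (2 ^ w.2.2 ≤ l ∧ 2 ^ 2 ^ l ≤ w.1) ∧ w.1 < 2 ^ 2 ^ (l + 1) ∧
        a * w.1 * l ≤ b * discrepancy (w.2.1.take w.1) ^ 2 := by
    let T := ℕ × (ℕ × List Bool × ℕ)
    have fl : Primrec fun t : T => t.1 := Primrec.fst
    have fn : Primrec fun t : T => t.2.1 := Primrec.fst.comp Primrec.snd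
    have fx : Primrec fun t : T => t.2.2.1 := Primrec.fst.comp (Primrec.snd.comp Primrec.snd)
    have fi : Primrec fun t : T => t.2.2.2 := Primrec.snd.comp (Primrec.snd.comp Primrec.snd)
    have two : ∀ {f : T → ℕ}, Primrec f → Primrec fun t => 2 ^ f t := fun hf =>
      primrec_pow.comp (Primrec.const 2) hf
    refine PrimrecPred.and (PrimrecPred.and ?_ ?_) (PrimrecPred.and ?_ ?_)
    · exact Primrec.nat_le.comp (two fi) fl
    · exact Primrec.nat_le.comp (two (two fl)) fn
    · exact Primrec.nat_lt.comp fn (two (two (Primrec.succ.comp fl)))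
    · exact Primrec.nat_le.comp
        (Primrec.nat_mul.comp (Primrec.nat_mul.comp (Primrec.const a) fn) fl)
        (Primrec.nat_mul.comp (Primrec.const b) (primrec_pow.comp
          (primrec_discrepancy.comp (Primrec.list_take.comp fn fx)) (Primrec.const 2)))
  have h1 : PrimrecRel fun (n : ℕ) (w : List Bool × ℕ) => ∃ l ∈ List.range (2 ^ (w.2 + 1)),
      (2 ^ w.2 ≤ l ∧ 2 ^ 2 ^ l ≤ n) ∧ n < 2 ^ 2 ^ (l + 1) ∧
        a * n * l ≤ b * discrepancy (w.1.take n) ^ 2 :=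
    h0.exists_mem_list.comp
      (Primrec.list_range.comp (primrec_pow.comp (Primrec.const 2)
        (Primrec.succ.comp (Primrec.snd.comp Primrec.snd)))) Primrec.id
  exact h1.exists_mem_list.comp
    (Primrec.list_range.comp (Primrec.succ.comp (Primrec.list_length.comp Primrec.fst)))
    Primrec.id

open scoped Classical in
/-- The strings of length `2 ^ 2 ^ 2 ^ (i + 1)` that deviate. -/
noncomputable def deviators (a b i : ℕ) : List (List Bool) :=
  (strings (2 ^ 2 ^ 2 ^ (i + 1))).filter fun x => Deviates a b i x

theorem primrec_scale : Primrec fun i : ℕ => 2 ^ 2 ^ 2 ^ (i + 1) := by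
  have two : ∀ {f : ℕ → ℕ}, Primrec f → Primrec fun t => 2 ^ f t := fun hf =>
    primrec_pow.comp (Primrec.const 2) hf
  exact two (two (two Primrec.succ))

theorem primrec_deviators (a b : ℕ) : Primrec (deviators a b) := by
  classical
  exact ((primrecRel_deviates a b).listFilter.comp (primrec_strings.comp primrec_scale)
    Primrec.id).of_eq fun i => by simp [deviators]

/-! ### Ville's inequality and a mixture of exponential supermartingales -/

open scoped Classical in
/-- Ville's inequality for nonnegative supermartingales on binary strings. -/
theorem length_filter_strings_le : ∀ (N : ℕ) (D : List Bool → ℝ), (∀ x, 0 ≤ D x) →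
    (∀ x, D (x ++ [true]) + D (x ++ [false]) ≤ 2 * D x) →
    (((strings N).filter fun x => ∃ n, 1 ≤ D (x.take n)).length : ℝ) ≤ 2 ^ N * D []
  | 0, D, h0, hD => by
      by_cases h : 1 ≤ D []
      · simp [strings, h]
      · simpa [strings, h] using h0 []
  | N + 1, D, h0, hD => by
      by_cases h : 1 ≤ D []
      · have h1 : (((strings (N + 1)).filter fun x => ∃ n, 1 ≤ D (x.take n)).length : ℝ)
            ≤ 2 ^ (N + 1) := by
          refine (Nat.cast_le.2 (List.length_filter_le _ _)).trans ?_
          simp [length_strings]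
        exact h1.trans (le_mul_of_one_le_right (by positivity) h)
      -- As D [] < 1, the threshold is not reached at n = 0. The event splits by the first bit, and
      -- each half is the same event for D on a subtree.
      · have key : ∀ (b : Bool) (x : List Bool), (∃ n, 1 ≤ D ((b :: x).take n)) ↔
            ∃ n, 1 ≤ D (b :: x.take n) := by
          intro b x
          constructor
          · rintro ⟨n | n, hn⟩
            · exact absurd (by simpa using hn) h
            · exact ⟨n, by simpa using hn⟩
          · rintro ⟨n, hn⟩
            exact ⟨n + 1, by simpa using hn⟩
        have ht := length_filter_strings_le N (fun x => D (true :: x)) (fun x => h0 _)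
          (fun x => hD (true :: x))
        have hf := length_filter_strings_le N (fun x => D (false :: x)) (fun x => h0 _)
          (fun x => hD (false :: x))
        have hs := hD []
        simp only [strings, List.filter_append, List.filter_map, List.length_append,
          List.length_map, Function.comp_def, key]
        push_cast
        simp only [List.nil_append] at hs
        calc _ ≤ 2 ^ N * D [true] + 2 ^ N * D [false] := add_le_add ht hf
          _ = 2 ^ N * (D [true] + D [false]) := by ring
          _ ≤ 2 ^ N * (2 * D []) := by gcongr
          _ = 2 ^ (N + 1) * D [] := by ring

/-- The number of ones minus the number of zeros. -/
def walk (x : List Bool) : ℝ := 2 * x.count true - x.length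

/-- One of the two truncated subtractions always vanishes. -/
theorem discrepancy_sq (x : List Bool) : (discrepancy x : ℝ) ^ 2 = walk x ^ 2 := by
  unfold discrepancy walk
  rcases le_total x.length (2 * x.count true) with h | h
  · rw [Nat.sub_eq_zero_of_le h]
    push_cast [Nat.cast_sub h]
    ring
  · rw [Nat.sub_eq_zero_of_le h]
    push_cast [Nat.cast_sub h]
    ring

/-- The exponential supermartingale with parameter `s`. -/
noncomputable def expMart (s : ℝ) (x : List Bool) : ℝ :=
  Real.exp (s * walk x - x.length * (s ^ 2 / 2))

/-- A fair sign has moment generating function cosh s ≤ exp(s² / 2), which the compensating factor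
cancels. -/
theorem expMart_step (s : ℝ) (x : List Bool) :
    expMart s (x ++ [true]) + expMart s (x ++ [false]) ≤ 2 * expMart s x := by
  have h1 : expMart s (x ++ [true]) = expMart s x * (Real.exp s * Real.exp (-(s ^ 2 / 2))) := by
    simp only [expMart, walk, ← Real.exp_add]
    congr 1
    simp
    ring
  have h2 : expMart s (x ++ [false]) =
      expMart s x * (Real.exp (-s) * Real.exp (-(s ^ 2 / 2))) := by
    simp only [expMart, walk, ← Real.exp_add]
    congr 1
    simp
    ring
  have h3 : Real.exp s + Real.exp (-s) ≤ 2 * Real.exp (s ^ 2 / 2) := by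
    have := Real.cosh_le_exp_half_sq s
    rw [Real.cosh_eq] at this
    linarith
  have h4 : Real.exp (s ^ 2 / 2) * Real.exp (-(s ^ 2 / 2)) = 1 := by
    rw [← Real.exp_add, add_neg_cancel, Real.exp_zero]
  have h5 : 0 ≤ expMart s x := (Real.exp_pos _).le
  rw [h1, h2]
  calc _ = expMart s x * ((Real.exp s + Real.exp (-s)) * Real.exp (-(s ^ 2 / 2))) := by ring
    _ ≤ expMart s x * (2 * Real.exp (s ^ 2 / 2) * Real.exp (-(s ^ 2 / 2))) := by gcongr
    _ = 2 * expMart s x := by rw [mul_assoc 2, h4]; ring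

/-- A large deviation at time `n` makes one of the supermartingales with parameters `±s` large,
when `s` is tuned to a time `m` slightly smaller than `n`. -/
theorem exp_le_expMart_add {s v m q : ℝ} {x : List Bool} (hs : 0 ≤ s) (hv : 0 ≤ v)
    (hsm : s ^ 2 * m = v) (h1 : m ≤ x.length) (h2 : x.length ≤ m * (1 + q))
    (hT : v * x.length ≤ walk x ^ 2) :
    Real.exp (v * (1 - q) / 2) ≤ expMart s x + expMart (-s) x := by
  -- Here s = √(v / m) and |walk x| ≥ √(v n) with n ≥ m. Subtracting the compensator, at most v (1 +
  -- q) / 2, leaves v (1 - q) / 2.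
  have ha : v ≤ s * |walk x| := by
    refine abs_le_of_sq_le_sq' ?_ (by positivity) |>.2
    rw [mul_pow, sq_abs]
    calc v ^ 2 = s ^ 2 * (v * m) := by rw [← hsm]; ring
      _ ≤ s ^ 2 * (v * x.length) := by gcongr
      _ ≤ s ^ 2 * walk x ^ 2 := by gcongr
  have hb : x.length * (s ^ 2 / 2) ≤ v * (1 + q) / 2 := by
    have : x.length * s ^ 2 ≤ m * (1 + q) * s ^ 2 := by gcongr
    have h3 : m * (1 + q) * s ^ 2 = v * (1 + q) := by rw [← hsm]; ring
    linarith
  rcases le_total 0 (walk x) with h | h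
  · rw [abs_of_nonneg h] at ha
    refine le_add_of_le_of_nonneg (Real.exp_le_exp.2 ?_) (Real.exp_pos _).le
    linarith
  · rw [abs_of_nonpos h] at ha
    refine le_add_of_nonneg_of_le (Real.exp_pos _).le (Real.exp_le_exp.2 ?_)
    rw [neg_sq]
    linarith

/-- The parameter tuned to the time `2 ^ (2 ^ l + t) * (1 + q / Q)`. -/
noncomputable def tuned (κ : ℝ) (Q l t q : ℕ) : ℝ :=
  Real.sqrt (κ * l / (2 ^ (2 ^ l + t) * (1 + q / Q)))

/-- A mixture of exponential supermartingales. -/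
noncomputable def mixture (κ : ℝ) (Q i : ℕ) (x : List Bool) : ℝ :=
  ∑ l ∈ (Finset.Ico (2 ^ i) (2 ^ (i + 1)) : Finset ℕ),
    ∑ t ∈ Finset.range (2 ^ l), ∑ q ∈ Finset.range Q,
    Real.exp (-(κ * l * (1 - 1 / Q) / 2)) *
      (expMart (tuned κ Q l t q) x + expMart (-tuned κ Q l t q) x)

theorem mixture_nonneg (κ : ℝ) (Q i : ℕ) (x : List Bool) : 0 ≤ mixture κ Q i x := by
  unfold mixture expMart
  positivity

theorem mixture_step (κ : ℝ) (Q i : ℕ) (x : List Bool) :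
    mixture κ Q i (x ++ [true]) + mixture κ Q i (x ++ [false]) ≤ 2 * mixture κ Q i x := by
  simp only [mixture, ← Finset.sum_add_distrib, Finset.mul_sum]
  refine Finset.sum_le_sum fun l _ => Finset.sum_le_sum fun t _ => Finset.sum_le_sum fun q _ => ?_
  have h1 := expMart_step (tuned κ Q l t q) x
  have h2 := expMart_step (-tuned κ Q l t q) x
  have h3 := Real.exp_pos (-(κ * l * (1 - 1 / Q) / 2))
  rw [← mul_add, mul_left_comm]
  gcongr
  linarith

/-- Every `expMart` starts at 1, so level l contributes 2 Q times 2^l weights. The number 2^l of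
dyadic scales is absorbed in the factor 2 of θ, and the 2^i levels are bounded by the lowest one. -/
theorem mixture_nil_le {κ : ℝ} {Q : ℕ} (i : ℕ) (hθ : 2 * Real.exp (-(κ * (1 - 1 / Q) / 2)) ≤ 1) :
    mixture κ Q i [] ≤
      2 * Q * (2 ^ i * (2 * Real.exp (-(κ * (1 - 1 / Q) / 2))) ^ 2 ^ i) := by
  set θ := 2 * Real.exp (-(κ * (1 - 1 / Q) / 2)) with hθ'
  have hθ0 : 0 ≤ θ := by positivity
  have h1 : mixture κ Q i [] =
      ∑ l ∈ (Finset.Ico (2 ^ i) (2 ^ (i + 1)) : Finset ℕ), 2 * Q * θ ^ l := by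
    refine Finset.sum_congr rfl fun l _ => ?_
    have h2 : Real.exp (-(κ * l * (1 - 1 / Q) / 2)) =
        Real.exp (-(κ * (1 - 1 / Q) / 2)) ^ l := by
      rw [← Real.exp_nat_mul]
      congr 1
      ring
    rw [h2, hθ', mul_pow]
    simp [expMart, walk]
    ring
  rw [h1]
  refine (Finset.sum_le_card_nsmul _ _ (2 * Q * θ ^ 2 ^ i) fun l hl => ?_).trans (le_of_eq ?_)
  · gcongr ?_ * ?_
    exact pow_le_pow_of_le_one hθ0 hθ (Finset.mem_Ico.1 hl).1
  · have : 2 ^ (i + 1) - 2 ^ i = 2 ^ i := by rw [pow_succ]; omega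
    rw [Nat.card_Ico, this, nsmul_eq_mul]
    push_cast
    ring

/-- A single summand suffices: its weight is the reciprocal of the lower bound in
`exp_le_expMart_add` for v = κ l and relative error 1 / Q. -/
theorem one_le_mixture {a b Q i : ℕ} (hb : 0 < b) (hQ : 0 < Q) {x : List Bool}
    (hx : Deviates a b i x) : ∃ n, 1 ≤ mixture (a / b) Q i (x.take n) := by
  obtain ⟨n, hn, l, hl, ⟨hil, hln⟩, hnl, hdev⟩ := hx
  rw [List.mem_range] at hn hl
  refine ⟨n, ?_⟩
  set y := x.take n with hy
  have hylen : y.length = n := by rw [hy, List.length_take]; omega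
  have hn0 : n ≠ 0 := by have := Nat.pos_of_ne_zero (pow_ne_zero (2 ^ l) two_ne_zero); omega
  obtain ⟨t, ht⟩ : ∃ t, Nat.log 2 n = 2 ^ l + t :=
    Nat.exists_eq_add_of_le (Nat.le_log_of_pow_le one_lt_two hln)
  have ht' : t < 2 ^ l := by
    have := Nat.log_lt_of_lt_pow hn0 hnl
    rw [pow_succ] at this
    omega
  have hlow : 2 ^ (2 ^ l + t) ≤ n := ht ▸ Nat.pow_log_le_self 2 hn0
  have hup : n < 2 ^ (2 ^ l + t + 1) := ht ▸ Nat.lt_pow_succ_log_self one_lt_two n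
  set P : ℕ := 2 ^ (2 ^ l + t) with hP
  have hP0 : 0 < P := by positivity
  -- Rounding down selects the last grid time P (1 + q / Q) not exceeding n; it misses n by less
  -- than P / Q.
  set q := Q * (n - P) / P with hq
  have hqQ : q < Q := by
    rw [hq, Nat.div_lt_iff_lt_mul hP0]
    refine Nat.mul_lt_mul_of_pos_left ?_ hQ
    rw [pow_succ] at hup
    omega
  have hq1 : (q : ℝ) * P ≤ Q * (n - P) := by
    rw [← Nat.cast_sub hlow]
    exact_mod_cast Nat.div_mul_le_self _ _
  have hq2 : (Q * (n - P) : ℝ) < (q + 1) * P := by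
    rw [← Nat.cast_sub hlow]
    have h := Nat.lt_mul_div_succ (Q * (n - P)) hP0
    rw [mul_comm P] at h
    exact_mod_cast h
  have hPR : (0 : ℝ) < P := by exact_mod_cast hP0
  have hQR : (0 : ℝ) < Q := by exact_mod_cast hQ
  have hbR : (0 : ℝ) < b := by exact_mod_cast hb
  have htuned : tuned (a / b) Q l t q = Real.sqrt (a / b * l / (P * (1 + q / Q))) := by
    rw [tuned, hP]
    push_cast
    rfl
  have key : Real.exp ((a / b * l : ℝ) * (1 - 1 / Q) / 2) ≤
      expMart (tuned (a / b) Q l t q) y + expMart (-tuned (a / b) Q l t q) y := by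
    refine exp_le_expMart_add (m := P * (1 + q / Q)) (Real.sqrt_nonneg _) (by positivity)
      ?_ ?_ ?_ ?_
    · rw [htuned, Real.sq_sqrt (by positivity)]
      field_simp
    · rw [hylen]
      have : (P * (1 + q / Q) : ℝ) = (Q * P + q * P) / Q := by field_simp
      rw [this, div_le_iff₀ hQR]
      linarith
    · rw [hylen]
      have h1 : (n : ℝ) ≤ P * (1 + q / Q) + P * (1 / Q) := by
        have : (P * (1 + q / Q) + P * (1 / Q) : ℝ) = (Q * P + (q + 1) * P) / Q := by
          field_simp
          ring
        rw [this, le_div_iff₀ hQR]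
        linarith
      have h2 : (P * (1 / Q) : ℝ) ≤ P * (1 + q / Q) * (1 / Q) := by
        gcongr
        exact le_mul_of_one_le_right hPR.le (le_add_of_nonneg_right (by positivity))
      linarith
    · rw [hylen, ← discrepancy_sq, div_mul_eq_mul_div, div_mul_eq_mul_div, div_le_iff₀ hbR]
      have : ((a * n * l : ℕ) : ℝ) ≤ ((b * discrepancy y ^ 2 : ℕ) : ℝ) := by exact_mod_cast hdev
      push_cast at this
      linarith
  have hterm : (1 : ℝ) ≤ Real.exp (-(a / b * l * (1 - 1 / Q) / 2)) *
      (expMart (tuned (a / b) Q l t q) y + expMart (-tuned (a / b) Q l t q) y) := by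
    rw [Real.exp_neg, ← div_eq_inv_mul, one_le_div (Real.exp_pos _)]
    exact key
  refine hterm.trans ?_
  unfold mixture
  have hnn : ∀ l t q : ℕ, 0 ≤ Real.exp (-(a / b * l * (1 - 1 / Q) / 2)) *
      (expMart (tuned (a / b) Q l t q) y + expMart (-tuned (a / b) Q l t q) y) := by
    intro l t q
    unfold expMart
    positivity
  refine le_trans ?_ (Finset.single_le_sum (fun l _ => Finset.sum_nonneg fun t _ =>
    Finset.sum_nonneg fun q _ => hnn l t q) (Finset.mem_Ico.2 ⟨hil, hl⟩))
  refine le_trans ?_ (Finset.single_le_sum (fun t _ =>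
    Finset.sum_nonneg fun q _ => hnn l t q) (Finset.mem_range.2 ht'))
  exact Finset.single_le_sum (f := fun q : ℕ => Real.exp (-(a / b * l * (1 - 1 / Q) / 2)) *
      (expMart (tuned (a / b) Q l t q) y + expMart (-tuned (a / b) Q l t q) y))
    (fun q _ => hnn l t q) (Finset.mem_range.2 hqQ)

/-! ### Counting the strings that deviate -/

theorem length_deviators_le {a b Q i : ℕ} (hb : 0 < b) (hQ : 0 < Q) :
    ((deviators a b i).length : ℝ) ≤ 2 ^ 2 ^ 2 ^ 2 ^ (i + 1) * mixture (a / b) Q i [] := by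
  classical
  refine le_trans ?_ (length_filter_strings_le _ (mixture (a / b) Q i) (mixture_nonneg _ _ _)
    (mixture_step _ _ _))
  rw [Nat.cast_le, deviators, ← List.countP_eq_length_filter, ← List.countP_eq_length_filter]
  refine List.countP_mono_left fun x _ hx => ?_
  simp only [decide_eq_true_eq] at hx ⊢
  exact one_le_mixture hb hQ hx

theorem eventually_length_deviators_le {a b : ℕ} (hb : 0 < b) (hab : 2 * Real.log 2 < a / b) :
    ∃ c : ℕ, 0 < c ∧ ∀ᶠ i : ℕ in atTop,
      (deviators a b i).length ≤ 2 ^ (2 ^ 2 ^ 2 ^ (i + 1) - 2 ^ i / c) := by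
  -- A fine enough grid keeps the loss 1 - 1 / Q from using up the margin of κ over 2 ln 2, so that
  -- θ < 1.
  obtain ⟨Q, hQ, hQ'⟩ : ∃ Q : ℕ, 0 < Q ∧ 2 * Real.log 2 < a / b * (1 - 1 / Q) := by
    have h1 : Tendsto (fun Q : ℕ => (a / b * (1 - 1 / Q) : ℝ)) atTop (nhds (a / b * (1 - 0))) :=
      (tendsto_const_nhds.sub tendsto_one_div_atTop_nhds_zero_nat).const_mul _
    rw [sub_zero, mul_one] at h1
    obtain ⟨Q, h2, h3⟩ := ((h1.eventually_const_lt hab).and (eventually_gt_atTop 0)).exists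
    exact ⟨Q, h3, h2⟩
  set θ : ℝ := 2 * Real.exp (-(a / b * (1 - 1 / Q) / 2)) with hθ
  have hθ0 : 0 < θ := by positivity
  have hθ1 : θ < 1 := by
    have h1 : Real.exp (-(a / b * (1 - 1 / Q) / 2)) < Real.exp (-Real.log 2) :=
      Real.exp_lt_exp.2 (by linarith)
    rw [Real.exp_neg (Real.log 2), Real.exp_log two_pos] at h1
    rw [hθ]
    linarith
  -- The slack between y and 1 / θ absorbs the prefactor 2 Q 2^i; the factor y^(2^i) that remains is
  -- worth at least 2^i / c bits once y^c > 2.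
  obtain ⟨y, hy1, hy2⟩ : ∃ y : ℝ, 1 < y ∧ y < θ⁻¹ := exists_between ((one_lt_inv₀ hθ0).2 hθ1)
  have hθy : θ * y < 1 := by rwa [lt_inv_comm₀ (by positivity) hθ0, ← one_div,
    lt_div_iff₀ (by positivity)] at hy2
  obtain ⟨c, hc⟩ := pow_unbounded_of_one_lt 2 hy1
  have hc0 : 0 < c := by
    rcases Nat.eq_zero_or_pos c with rfl | h
    · norm_num at hc
    · exact h
  refine ⟨c, hc0, ?_⟩
  have hlim : Tendsto (fun u : ℕ => 2 * Q * ((u : ℝ) * (θ * y) ^ u)) atTop (nhds (2 * Q * 0)) :=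
    (tendsto_self_mul_const_pow_of_lt_one (by positivity) hθy).const_mul _
  rw [mul_zero] at hlim
  have hpow : Tendsto (fun i : ℕ => 2 ^ i) atTop atTop :=
    tendsto_pow_atTop_atTop_of_one_lt (one_lt_two : 1 < (2 : ℕ))
  filter_upwards [hpow.eventually (hlim.eventually_le_const one_pos)] with i hi
  push_cast at hi
  set M := 2 ^ 2 ^ 2 ^ (i + 1) with hM
  have hle : 2 ^ i / c ≤ M := by
    refine (Nat.div_le_self _ _).trans ?_
    have h1 : i ≤ 2 ^ 2 ^ (i + 1) :=
      (Nat.lt_two_pow_self.le.trans Nat.lt_two_pow_self.le : i ≤ 2 ^ 2 ^ i).trans (by gcongr <;> omega)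
    rw [hM]
    gcongr
    omega
  have h2 : (2 : ℝ) ^ (2 ^ i / c) ≤ y ^ 2 ^ i := calc
    (2 : ℝ) ^ (2 ^ i / c) ≤ (y ^ c) ^ (2 ^ i / c) := by gcongr
    _ = y ^ (c * (2 ^ i / c)) := (pow_mul _ _ _).symm
    _ ≤ y ^ 2 ^ i := pow_le_pow_right₀ hy1.le (Nat.mul_div_le _ _)
  have h3 : mixture (a / b) Q i [] * 2 ^ (2 ^ i / c) ≤ 1 := calc
    _ ≤ 2 * Q * (2 ^ i * θ ^ 2 ^ i) * y ^ 2 ^ i := by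
        gcongr
        exact mixture_nil_le i hθ1.le
    _ = 2 * Q * (2 ^ i * (θ * y) ^ 2 ^ i) := by rw [mul_pow]; ring
    _ ≤ 1 := hi
  have h4 : ((deviators a b i).length : ℝ) ≤ 2 ^ (M - 2 ^ i / c) := by
    refine (length_deviators_le hb hQ).trans ?_
    have h5 : (2 : ℝ) ^ M = 2 ^ (M - 2 ^ i / c) * 2 ^ (2 ^ i / c) := by
      rw [← pow_add, Nat.sub_add_cancel hle]
    rw [← hM, h5, mul_assoc]
    refine mul_le_of_le_one_right (by positivity) ?_
    rwa [mul_comm]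
  exact_mod_cast h4

/-- Strings that deviate have short descriptions. -/
theorem exists_Km_le_of_deviates {a b : ℕ} (hb : 0 < b) (hab : 2 * Real.log 2 < a / b) :
    ∃ c C : ℕ, 0 < c ∧ ∀ᶠ i : ℕ in atTop, ∀ x : List Bool,
      x.length = 2 ^ 2 ^ 2 ^ (i + 1) → Deviates a b i x →
      Km x ≤ i + (2 ^ 2 ^ 2 ^ (i + 1) - 2 ^ i / c) + C := by
  obtain ⟨c, hc, hev⟩ := eventually_length_deviators_le hb hab
  have hL : Primrec fun i : ℕ => 2 ^ 2 ^ 2 ^ (i + 1) - 2 ^ i / c :=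
    Primrec.nat_sub.comp primrec_scale
      (Primrec.nat_div.comp (primrec_pow.comp (Primrec.const 2) Primrec.id) (Primrec.const c))
  obtain ⟨C, hC⟩ := exists_Km_le_of_mem_list (primrec_deviators a b) hL
  refine ⟨c, C, hc, hev.mono fun i hi x hx hd => hC i hi x ?_⟩
  simp [deviators, mem_strings, hx, hd]

end MonotoneComplexity

/-! ### From violations of the law to deviating initial segments -/

theorem length_initialSegment (ω : ℕ → Bool) (m : ℕ) : (initialSegment ω m).length = m := by
  simp [initialSegment]

theorem take_initialSegment (ω : ℕ → Bool) {n m : ℕ} (h : n ≤ m) :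
    (initialSegment ω m).take n = initialSegment ω n := by
  refine List.ext_getElem (by simpa [initialSegment] using h) fun k h1 h2 => ?_
  simp [initialSegment]

theorem initialSegment_succ (ω : ℕ → Bool) (n : ℕ) :
    initialSegment ω (n + 1) = initialSegment ω n ++ [ω n] := by
  rw [initialSegment, List.ofFn_succ_last]
  rfl

theorem count_initialSegment (ω : ℕ → Bool) (n : ℕ) :
    (initialSegment ω n).count true = partialSum ω n := by
  induction n with
  | zero => simp [initialSegment, partialSum]
  | succ n ih =>
    rw [initialSegment_succ, List.count_append, ih, partialSum, partialSum,
      Finset.sum_range_succ]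
    cases ω n <;> simp

open MonotoneComplexity

theorem discrepancy_initialSegment_sq (ω : ℕ → Bool) (n : ℕ) :
    (discrepancy (initialSegment ω n) : ℝ) ^ 2 = 4 * |(partialSum ω n : ℝ) - n / 2| ^ 2 := by
  rw [discrepancy_sq, walk, count_initialSegment, length_initialSegment, sq_abs]
  ring

theorem tendsto_log_log_atTop : Tendsto (fun n : ℕ => Real.log (Real.log n)) atTop atTop :=
  Real.tendsto_log_atTop.comp (Real.tendsto_log_atTop.comp tendsto_natCast_atTop_atTop)

/-- The integer iterated logarithm to base two is at most the real one. -/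
theorem log_log_mul_log_two_le {n : ℕ} (hn : 1 < n) :
    (Nat.log 2 (Nat.log 2 n) : ℝ) * Real.log 2 ≤ Real.log (Real.log n) - Real.log (Real.log 2) := by
  have h2 : 0 < Real.log 2 := Real.log_pos one_lt_two
  have h1 : ∀ k : ℕ, k ≠ 0 → (Nat.log 2 k : ℝ) * Real.log 2 ≤ Real.log k := fun k hk => by
    rw [← Real.log_pow]
    refine Real.log_le_log (by positivity) ?_
    exact_mod_cast Nat.pow_log_le_self 2 hk
  have h3 : Nat.log 2 n ≠ 0 := (Nat.log_pos one_lt_two hn).ne'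
  have h4 := h1 n (by omega)
  refine (h1 _ h3).trans ?_
  have h5 : 0 < (Nat.log 2 n : ℝ) := by exact_mod_cast Nat.pos_of_ne_zero h3
  rw [← Real.log_div (by nlinarith) h2.ne']
  exact Real.log_le_log h5 ((le_div_iff₀ h2).2 h4)

/-- A violation of the law of the iterated logarithm at a large time makes an initial segment
deviate. -/
theorem eventually_deviates (ω : ℕ → Bool) {a b : ℕ} {r : ℝ} (hb : 0 < b) (hr : 0 < r)
    (hab : (a / b : ℝ) < 2 * Real.log 2 * r ^ 2) :
    ∀ᶠ n : ℕ in atTop,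
      r < |(partialSum ω n : ℝ) - n / 2| / Real.sqrt (1 / 2 * n * Real.log (Real.log n)) →
      Deviates a b (Nat.log 2 (Nat.log 2 (Nat.log 2 n)))
        (initialSegment ω (2 ^ 2 ^ 2 ^ (Nat.log 2 (Nat.log 2 (Nat.log 2 n)) + 1))) := by
  have hl2 : 0 < Real.log 2 := Real.log_pos one_lt_two
  have hκ : (a / b : ℝ) / Real.log 2 < 2 * r ^ 2 := by
    rw [div_lt_iff₀ hl2]
    linarith
  -- The strict gap between κ / ln 2 and 2 r² absorbs the constant -ln ln 2 that arises in passing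
  -- from l to ln ln n.
  have hlim : Tendsto (fun n : ℕ =>
      (2 * r ^ 2 - a / b / Real.log 2) * Real.log (Real.log n)) atTop atTop :=
    tendsto_log_log_atTop.const_mul_atTop (sub_pos.2 hκ)
  filter_upwards [eventually_ge_atTop 4, tendsto_log_log_atTop.eventually_gt_atTop 0,
    hlim.eventually_ge_atTop (-(a / b / Real.log 2 * Real.log (Real.log 2)))] with n hn hpos hlarge h
  have hn0 : n ≠ 0 := by omega
  have hj : 2 ≤ Nat.log 2 n := Nat.le_log_of_pow_le one_lt_two (by simpa using hn)
  have hl : 1 ≤ Nat.log 2 (Nat.log 2 n) := Nat.le_log_of_pow_le one_lt_two (by simpa using hj)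
  have hu : ∀ k, k < 2 ^ (Nat.log 2 k + 1) := Nat.lt_pow_succ_log_self one_lt_two
  set j := Nat.log 2 n with hjd
  set l := Nat.log 2 j with hld
  set i := Nat.log 2 l with hid
  have hli : l < 2 ^ (i + 1) := hu l
  have hjl : j < 2 ^ (l + 1) := hu j
  have hnj : n < 2 ^ (j + 1) := hu n
  have hnl : n < 2 ^ 2 ^ (l + 1) := hnj.trans_le (by gcongr <;> omega)
  have hnM : n < 2 ^ 2 ^ 2 ^ (i + 1) := hnl.trans_le (by gcongr <;> omega)
  refine ⟨n, ?_, l, List.mem_range.2 hli, ⟨Nat.pow_log_le_self 2 (by omega), ?_⟩, hnl, ?_⟩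
  · rw [length_initialSegment, List.mem_range]
    omega
  · calc 2 ^ 2 ^ l ≤ 2 ^ j := by gcongr; exacts [one_le_two, Nat.pow_log_le_self 2 (by omega)]
      _ ≤ n := Nat.pow_log_le_self 2 hn0
  · rw [take_initialSegment ω hnM.le]
    have hbR : (0 : ℝ) < b := by exact_mod_cast hb
    have hnR : (0 : ℝ) < n := by positivity
    have hs : 0 < 1 / 2 * (n : ℝ) * Real.log (Real.log n) := by positivity
    rw [lt_div_iff₀ (Real.sqrt_pos.2 hs)] at h
    have h2 : r ^ 2 * (1 / 2 * n * Real.log (Real.log n)) ≤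
        |(partialSum ω n : ℝ) - n / 2| ^ 2 := by
      rw [← Real.sq_sqrt hs.le, ← mul_pow]
      gcongr
    have h3 : (a / b : ℝ) * l ≤ 2 * r ^ 2 * Real.log (Real.log n) := by
      have h4 := mul_le_mul_of_nonneg_left (log_log_mul_log_two_le (n := n) (by omega))
        (by positivity : (0 : ℝ) ≤ a / b / Real.log 2)
      have h5 : (a / b / Real.log 2 : ℝ) * (l * Real.log 2) = a / b * l := by field_simp
      rw [h5] at h4
      linarith
    have h6 : (a / b : ℝ) * l * n ≤ (discrepancy (initialSegment ω n) : ℝ) ^ 2 := by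
      rw [discrepancy_initialSegment_sq]
      have := mul_le_mul_of_nonneg_right h3 hnR.le
      linarith
    have h7 : (a * n * l : ℝ) ≤ b * (discrepancy (initialSegment ω n) : ℝ) ^ 2 := by
      have h8 : (a * n * l : ℝ) = b * (a / b * l * n) := by field_simp
      rw [h8]
      gcongr
    exact_mod_cast h7

/-! ### Deviations against the complexity deficiency -/

theorem tendsto_natLog_two : Tendsto (Nat.log 2) atTop atTop :=
  Nat.log_monotone.tendsto_atTop_atTop fun k => ⟨2 ^ k, by simp [Nat.log_pow]⟩

theorem exists_nat_div_btwn {x y : ℝ} (hx : 0 ≤ x) (hxy : x < y) :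
    ∃ a b : ℕ, 0 < b ∧ x < a / b ∧ (a / b : ℝ) < y := by
  obtain ⟨q, h1, h2⟩ := exists_rat_btwn hxy
  have hq : 0 < q := by exact_mod_cast hx.trans_lt h1
  have h3 : (q : ℝ) = (q.num.toNat : ℝ) / q.den := by
    have h4 : ((q.num.toNat : ℤ) : ℝ) = q.num := by
      rw [Int.toNat_of_nonneg (Rat.num_pos.2 hq).le]
    rw [Int.cast_natCast] at h4
    rw [h4, Rat.cast_def]
  exact ⟨q.num.toNat, q.den, q.den_pos, h3 ▸ h1, h3 ▸ h2⟩

/-- A complexity deficiency of smaller order than `log₂ log₂ m` excludes frequent deviations. -/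
theorem eventually_not_deviates {a b : ℕ} (hb : 0 < b) (hab : 2 * Real.log 2 < a / b)
    {ρ : ℕ → ℝ} (hρ : ρ =o[atTop] fun m : ℕ => Real.logb 2 (Real.logb 2 (m : ℝ)))
    {ω : ℕ → Bool} {c : ℝ} (hω : ∀ m : ℕ, (m : ℝ) - ρ m - c ≤ (Km (initialSegment ω m) : ℝ)) :
    ∀ᶠ i : ℕ in atTop, ¬ Deviates a b i (initialSegment ω (2 ^ 2 ^ 2 ^ (i + 1))) := by
  obtain ⟨d, C, hd, hev⟩ := exists_Km_le_of_deviates hb hab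
  have hdR : (0 : ℝ) < d := by exact_mod_cast hd
  have hscale : Tendsto (fun i : ℕ => 2 ^ 2 ^ 2 ^ (i + 1)) atTop atTop :=
    tendsto_atTop_mono (fun i => (Nat.le_succ i).trans (Nat.lt_two_pow_self.le.trans
      (Nat.lt_two_pow_self.le.trans Nat.lt_two_pow_self.le))) tendsto_id
  -- With 1 / (4 d), |ρ(M)| ≤ 2^(i+1) / (4 d), half of the saving 2^i / d. The other half outgrows i
  -- plus the constants, where the 1 pays for rounding 2^i / d down.
  have hsmall := hscale.eventually (hρ.bound (show 0 < 1 / (4 * (d : ℝ)) by positivity))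
  have hlim : Tendsto (fun i : ℕ => (2 : ℝ) ^ i * (1 / (2 * d)) - i) atTop atTop := by
    have h1 : Tendsto (fun i : ℕ => (i : ℝ) ^ 1 / 2 ^ i) atTop (nhds 0) :=
      tendsto_pow_const_div_const_pow_of_one_lt 1 one_lt_two
    have h2 : Tendsto (fun i : ℕ => 1 / (2 * (d : ℝ)) - (i : ℝ) ^ 1 / 2 ^ i) atTop
        (nhds (1 / (2 * (d : ℝ)) - 0)) := tendsto_const_nhds.sub h1
    have h3 : Tendsto (fun i : ℕ => (2 : ℝ) ^ i) atTop atTop :=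
      tendsto_pow_atTop_atTop_of_one_lt one_lt_two
    refine (h3.atTop_mul_pos (by rw [sub_zero]; positivity) h2).congr fun i => ?_
    field_simp
  filter_upwards [hev, hsmall, hlim.eventually_gt_atTop (C + c + 1)] with i h1 h2 h3 hdev
  set M := 2 ^ 2 ^ 2 ^ (i + 1) with hM
  have h4 := h1 _ (length_initialSegment ω M) hdev
  have h5 := hω M
  have h6 : Real.logb 2 (Real.logb 2 (M : ℝ)) = 2 ^ (i + 1) := by
    rw [hM]
    push_cast
    rw [Real.logb_pow, Real.logb_self_eq_one one_lt_two, mul_one]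
    push_cast
    rw [Real.logb_pow, Real.logb_self_eq_one one_lt_two, mul_one]
    push_cast
    rfl
  rw [h6, Real.norm_eq_abs, Real.norm_of_nonneg (by positivity)] at h2
  have h7 : ρ M ≤ 2 ^ i * (1 / (2 * d)) := by
    refine (le_abs_self _).trans (h2.trans (le_of_eq ?_))
    rw [pow_succ]
    field_simp
    norm_num
  have hle : 2 ^ i / d ≤ M := by
    refine (Nat.div_le_self _ _).trans ?_
    have h1 : i ≤ 2 ^ 2 ^ (i + 1) := (Nat.le_succ i).trans
      (Nat.lt_two_pow_self.le.trans Nat.lt_two_pow_self.le)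
    rw [hM]
    gcongr
    exact one_le_two
  have h8 : (Km (initialSegment ω M) : ℝ) ≤ i + (M - (2 ^ i / d : ℕ)) + C := by
    rw [← Nat.cast_sub hle]
    exact_mod_cast h4
  have h9 : (2 ^ i / d : ℝ) < (2 ^ i / d : ℕ) + 1 := by
    rw [div_lt_iff₀ hdR]
    have h := Nat.lt_mul_div_succ (2 ^ i) hd
    rw [mul_comm d] at h
    exact_mod_cast h
  have h10 : (2 ^ i / d : ℝ) = 2 ^ i * (1 / (2 * d)) + 2 ^ i * (1 / (2 * d)) := by
    field_simp
    norm_num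
  linarith

theorem mainTheorem3 (ρ : ℕ → ℝ) (hcomp : IsComputableReal ρ) (hmono : Monotone ρ)
    (hunbdd : ¬ BddAbove (Set.range ρ))
    (hlittle : ρ =o[atTop] fun m : ℕ => Real.logb 2 (Real.logb 2 (m : ℝ)))
    (ω : ℕ → Bool)
    (hω : ∃ c : ℝ, ∀ m : ℕ,
      (m : ℝ) - ρ m - c ≤ (MonotoneComplexity.Km (initialSegment ω m) : ℝ)) :
    limsup (fun n : ℕ =>
        ((|(partialSum ω n : ℝ) - (n : ℝ) / 2| /
          Real.sqrt ((1 / 2) * (n : ℝ) * Real.log (Real.log (n : ℝ))) : ℝ) : EReal)) atTop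
      ≤ (1 : EReal) := by
  obtain ⟨c, hc⟩ := hω
  by_contra! hlt
  obtain ⟨r, h1r, hr⟩ := EReal.lt_iff_exists_real_btwn.1 hlt
  have hr1 : 1 < r := by exact_mod_cast h1r
  have hl2 : 0 < Real.log 2 := Real.log_pos one_lt_two
  -- The lower bound on a / b makes deviating strings compressible; the upper bound makes violations
  -- by the factor r deviations.
  obtain ⟨a, b, hb, hab, hab'⟩ := exists_nat_div_btwn (x := 2 * Real.log 2)
    (y := 2 * Real.log 2 * r ^ 2) (by positivity)
    (lt_mul_of_one_lt_right (by positivity) (one_lt_pow₀ hr1 two_ne_zero))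
  have hfreq := frequently_lt_of_lt_limsup (by isBoundedDefault) hr
  -- The block index of n is its threefold integer logarithm, which tends to infinity, so a property
  -- of all large i holds at the blocks of all large n.
  have hev := (tendsto_natLog_two.comp (tendsto_natLog_two.comp tendsto_natLog_two)).eventually
    (eventually_not_deviates hb hab hlittle hc)
  obtain ⟨n, hn, hdev, hnot⟩ := (hfreq.and_eventually
    ((eventually_deviates ω hb (one_pos.trans hr1) hab').and hev)).exists
  exact hnot (hdev (by exact_mod_cast hn))
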